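/- **Fireball Calculus (FBC).** Terms, up to $\alpha$-equivalence, are $t,u ::= x \mid a \mid \lambda x.t \mid tu$, where $x$ ranges over variables and $a$ over a set of symbols (which are never bound). *Fireballs* are $f ::= \lambda x.t \mid A$ and *inerts* are $A ::= a \mid A f$. *Evaluation contexts* are $E ::= \langle\cdot\rangle \mid tE \mid Ef$. The strategy $\to_{\mathsf f}$ is given by $E\langle(\lambda x.t)f\rangle \to_{\mathsf f} E\langle t\{x{\leftarrow}f\}\rangle$. **Useful Fireball Calculus.** Terms with explicit substitutions (ES), up to $\alpha$-equivalence, are $t,u ::= x \mid a \mid \lambda x.t \mid tu \mid t[x{\leftarrow}u]$, with $x$ bound in $t$ in $t[x{\leftarrow}u]$. The *unfolding* $t{\downarrow}$ of $t$ is the FBC term obtained by executing all ES, i.e. ${\downarrow}$ commutes with the other constructors and $(t[x{\leftarrow}u]){\downarrow} = t{\downarrow}\{x{\leftarrow}u{\downarrow}\}$. *Shallow contexts* are $S ::= \langle\cdot\rangle \mid St \mid tS \mid S[x{\leftarrow}t]$ and *substitution contexts* are $L ::= \langle\cdot\rangle \mid L[x{\leftarrow}t]$; plugging may capture variables. The *unfolding*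 $t{\downarrow_S}$ *of $t$ relative to $S$* is defined by $t{\downarrow_{\langle\cdot\rangle}} = t{\downarrow}$, $t{\downarrow_{uS}} = t{\downarrow_{Su}} = t{\downarrow_S}$, $t{\downarrow_{S[x\leftarrow u]}} = t{\downarrow_S}\{x{\leftarrow}u{\downarrow}\}$. *Evaluable* contexts are defined inductively: $\langle\cdot\rangle$ is evaluable; $tS$ is evaluable if $S$ is; $St$ is evaluable if $S$ is and $t{\downarrow}$ is a fireball; $S[x{\leftarrow}t]$ is evaluable if $S\{x{\leftarrow}t{\downarrow}\}$ is and $t{\downarrow}$ is a fireball. $S$ is *applicative* if $S = S'\langle Lu\rangle$ for some $S', L, u$, and *useful* if it is evaluable and applicative. The strategy $\multimap_{\mathsf{uf}}$ is the union of the multiplicative ($\mathsf m$) steps $$S\langle L\langle\lambda x.t\rangle u\rangle \multimap S\langle L\langle t[x{\leftarrow}u]\rangle\rangle \quad\text{if } S\langle Lu\rangle \text{ is useful}$$ and of the exponential ($\mathsf e$) steps $$S\langle S'\langle x\rangle[x{\leftarrow}L\langle u\rangle]\rangle \multimap S\langle L\langle S'\langle u\rangle[x{\leftarrow}u]\rangle\rangle$$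 if $S\langle S'[x{\leftarrow}L\langle u\rangle]\rangle$ is useful, $u$ is not of the form $u'[y{\leftarrow}w]$, and $u{\downarrow_{S\langle L\rangle}}$ is an abstraction (here $S'$ does not bind $x$, and bound variables are renamed so that no free variable of $u$ is captured by $S'$ or $x$ and none of the parts entering the scope of $L$ is captured by $L$). For a derivation $d$, write $|d|$, $|d|_{\mathsf m}$ for its length and its number of $\mathsf m$-steps. **Theorem (Quadratic High-Level Implementation).** $(\to_{\mathsf f},\multimap_{\mathsf{uf}})$ is a locally bounded high-level implementation system, and $\multimap_{\mathsf{uf}}$ implements $\to_{\mathsf f}$ with quadratic overhead. That is: 1. *(Determinism)* $\to_{\mathsf f}$ and $\multimap_{\mathsf{uf}}$ are deterministic (for the latter, a term has at most one reduct, and the kind $\mathsf m$/$\mathsf e$ of the step is determined). 2. For every term $t$ without ES and every derivation $d : t \multimap_{\mathsf{uf}}^* u$: (a) *(Normal form)* if $u$ is $\multimap_{\mathsf{uf}}$-normal then $u{\downarrow}$ is $\to_{\mathsf f}$-normal; (b) *(Projection)* there is a derivation $d{\downarrow} : t{\downarrow} \to_{\mathsf f}^* u{\downarrow}$ with $|d{\downarrow}|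 = |d|_{\mathsf m}$. 3. *(Local bound)* There is a constant $c$ such that for all $t$ and $d : t\multimap_{\mathsf{uf}}^* u$ as in 2, every sequence of $\mathsf e$-steps starting from $u$ has length at most $c\cdot|d|_{\mathsf m}$. 4. *(Normalisation)* A term $t$ without ES is $\to_{\mathsf f}$-normalising if and only if it is $\multimap_{\mathsf{uf}}$-normalising. 5. *(Quadratic overhead)* There is a constant $c$ such that, for every term $t$ without ES: every $d : t \multimap_{\mathsf{uf}}^* u$ projects to a derivation $d{\downarrow} : t \to_{\mathsf f}^* u{\downarrow}$ with $|d{\downarrow}| = |d|_{\mathsf m}$ and $|d| \le c\cdot|d{\downarrow}|^2$; and whenever $t \to_{\mathsf f}^h s$ there is $d : t \multimap_{\mathsf{uf}}^* u$ with $u{\downarrow} = s$, $|d|_{\mathsf m} = h$ and $|d| \le c\cdot h^2$. -/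

import Mathlib

namespace FireballCalculus

/-! ### The Fireball Calculus

Terms are taken up to α-equivalence by means of de Bruijn indices: `var n` is a variable
(bound by the `n`-th enclosing binder, or free if there are not that many binders), and `sym a` is
the symbol `a`, which is never bound. -/

/-- Terms of the Fireball Calculus: `x | a | λx.t | t u`. -/
inductive FTerm (σ : Type*) where
  | var (n : ℕ) : FTerm σ
  | sym (a : σ) : FTerm σ
  | lam (t : FTerm σ) : FTerm σ
  | app (t u : FTerm σ) : FTerm σ

/-- A renaming of indices, moved under one binder. -/
def liftRen (f : ℕ → ℕ) : ℕ → ℕ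
  | 0 => 0
  | n + 1 => f n + 1

namespace FTerm

variable {σ : Type*}

def rename : (ℕ → ℕ) → FTerm σ → FTerm σ
  | f, var n => var (f n)
  | _, sym a => sym a
  | f, lam t => lam (t.rename (liftRen f))
  | f, app t u => app (t.rename f) (u.rename f)

/-- A parallel substitution, moved under one binder. -/
def liftSub (τ : ℕ → FTerm σ) : ℕ → FTerm σ
  | 0 => var 0
  | n + 1 => (τ n).rename Nat.succ

/-- Capture-avoiding parallel substitution. -/
def subst : (ℕ → FTerm σ) → FTerm σ → FTerm σ
  | τ, var n => τ n
  | _, sym a => sym a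
  | τ, lam t => lam (t.subst (liftSub τ))
  | τ, app t u => app (t.subst τ) (u.subst τ)

/-- The parallel substitution replacing index `0` by `u` and decrementing all other indices. -/
def single (u : FTerm σ) : ℕ → FTerm σ
  | 0 => u
  | n + 1 => var n

/-- `t{x ← u}`, where `x` is index `0` of `t`. -/
def inst (t u : FTerm σ) : FTerm σ := t.subst (single u)

/-- Values: abstractions. -/
def IsValue : FTerm σ → Prop
  | lam _ => True
  | _ => False

/-- Inerts `A ::= a | A f`, where `f` is a value or an inert. -/
def IsInert : FTerm σ → Prop
  | sym _ => True
  | app t u => t.IsInert ∧ (u.IsValue ∨ u.IsInert)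
  | _ => False

/-- Fireballs `f ::= v | A`. -/
def IsFireball (t : FTerm σ) : Prop := t.IsValue ∨ t.IsInert

end FTerm

/-- Contexts of the Fireball Calculus; `left E u` is `E u` and `right t E` is `t E`. -/
inductive FCtx (σ : Type*) where
  | hole : FCtx σ
  | left (E : FCtx σ) (u : FTerm σ) : FCtx σ
  | right (t : FTerm σ) (E : FCtx σ) : FCtx σ

namespace FCtx

variable {σ : Type*}

def plug : FCtx σ → FTerm σ → FTerm σ
  | hole, r => r
  | left E u, r => .app (E.plug r) u
  | right t E, r => .app t (E.plug r)

/-- Evaluation contexts `E ::= ⟨·⟩ | t E | E f`. -/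
def IsEvaluation : FCtx σ → Prop
  | hole => True
  | left E u => E.IsEvaluation ∧ u.IsFireball
  | right _ E => E.IsEvaluation

end FCtx

/-- The fireball strategy: `E⟨(λx.t) f⟩ → E⟨t{x ← f}⟩`. -/
inductive FStep {σ : Type*} : FTerm σ → FTerm σ → Prop
  | fire (E : FCtx σ) (t f : FTerm σ) (hE : E.IsEvaluation) (hf : f.IsFireball) :
      FStep (E.plug (.app (.lam t) f)) (E.plug (t.inst f))

/-! ### Terms with explicit substitutions -/

/-- Terms with explicit substitutions: `x | a | λx.t | t u | t[x ← u]`.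
In `es t u` (standing for `t[x ← u]`), index `0` is bound in `t` and nothing is bound in `u`. -/
inductive ETerm (σ : Type*) where
  | var (n : ℕ) : ETerm σ
  | sym (a : σ) : ETerm σ
  | lam (t : ETerm σ) : ETerm σ
  | app (t u : ETerm σ) : ETerm σ
  | es (t u : ETerm σ) : ETerm σ

namespace ETerm

variable {σ : Type*}

def rename : (ℕ → ℕ) → ETerm σ → ETerm σ
  | f, var n => var (f n)
  | _, sym a => sym a
  | f, lam t => lam (t.rename (liftRen f))
  | f, app t u => app (t.rename f) (u.rename f)
  | f, es t u => es (t.rename (liftRen f)) (u.rename f)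

/-- Weakening: move `t` under `n` further binders. -/
def shift (n : ℕ) (t : ETerm σ) : ETerm σ := t.rename (· + n)

/-- A parallel substitution, moved under one binder. -/
def liftSub (τ : ℕ → ETerm σ) : ℕ → ETerm σ
  | 0 => var 0
  | n + 1 => (τ n).rename Nat.succ

/-- Capture-avoiding parallel substitution. -/
def subst : (ℕ → ETerm σ) → ETerm σ → ETerm σ
  | τ, var n => τ n
  | _, sym a => sym a
  | τ, lam t => lam (t.subst (liftSub τ))
  | τ, app t u => app (t.subst τ) (u.subst τ)
  | τ, es t u => es (t.subst (liftSub τ)) (u.subst τ)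

/-- The parallel substitution replacing index `0` by `u` and decrementing all other indices. -/
def single (u : ETerm σ) : ℕ → ETerm σ
  | 0 => u
  | n + 1 => var n

/-- The unfolding of a term: all explicit substitutions are executed. -/
def unfold : ETerm σ → FTerm σ
  | var n => .var n
  | sym a => .sym a
  | lam t => .lam t.unfold
  | app t u => .app t.unfold u.unfold
  | es t u => t.unfold.inst u.unfold

/-- The term is of the form `t[x ← u]`. -/
def IsES : ETerm σ → Prop
  | es _ _ => True
  | _ => False

end ETerm

/-- An ordinary λ-term, seen as a term with (no) explicit substitutions. -/
def FTerm.embed {σ : Type*} : FTerm σ → ETerm σ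
  | .var n => .var n
  | .sym a => .sym a
  | .lam t => .lam t.embed
  | .app t u => .app t.embed u.embed

theorem FTerm.unfold_embed {σ : Type*} (t : FTerm σ) : t.embed.unfold = t := by
  induction t <;> simp_all [FTerm.embed, ETerm.unfold]

/-- Shallow contexts `S ::= ⟨·⟩ | S t | t S | S[x ← t]`, with constructors in this order.
In `es S t`, index `0` is bound in `S` (and in whatever is plugged in its hole). -/
inductive SCtx (σ : Type*) where
  | hole : SCtx σ
  | left (S : SCtx σ) (t : ETerm σ) : SCtx σ
  | right (t : ETerm σ) (S : SCtx σ) : SCtx σ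
  | es (S : SCtx σ) (t : ETerm σ) : SCtx σ

namespace SCtx

variable {σ : Type*}

/-- Plugging `S⟨r⟩`, which may capture variables: `r` lives under the binders of `S`. -/
def plug : SCtx σ → ETerm σ → ETerm σ
  | hole, r => r
  | left S t, r => .app (S.plug r) t
  | right t S, r => .app t (S.plug r)
  | es S t, r => .es (S.plug r) t

/-- Plugging `S⟨S'⟩` of a context in a context. -/
def comp : SCtx σ → SCtx σ → SCtx σ
  | hole, S' => S'
  | left S t, S' => left (S.comp S') t
  | right t S, S' => right t (S.comp S')
  | es S t, S' => es (S.comp S') t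

/-- The number of binders above the hole. -/
def depth : SCtx σ → ℕ
  | hole => 0
  | left S _ => S.depth
  | right _ S => S.depth
  | es S _ => S.depth + 1

/-- Substitution contexts `L ::= ⟨·⟩ | L[x ← t]`. -/
def IsSubstitution : SCtx σ → Prop
  | hole => True
  | es L _ => L.IsSubstitution
  | _ => False

def rename : (ℕ → ℕ) → SCtx σ → SCtx σ
  | _, hole => hole
  | f, left S t => left (S.rename f) (t.rename f)
  | f, right t S => right (t.rename f) (S.rename f)
  | f, es S t => es (S.rename (liftRen f)) (t.rename f)

/-- Implicit (capture-avoiding) substitution on shallow contexts. -/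
def subst : (ℕ → ETerm σ) → SCtx σ → SCtx σ
  | _, hole => hole
  | τ, left S t => left (S.subst τ) (t.subst τ)
  | τ, right t S => right (t.subst τ) (S.subst τ)
  | τ, es S t => es (S.subst (ETerm.liftSub τ)) (t.subst τ)

/-- `S{x ← u}`, where `x` is index `0` of `S`. -/
def inst (S : SCtx σ) (u : ETerm σ) : SCtx σ := S.subst (ETerm.single u)

/-- The unfolding of `t` relative to the shallow context `S`. -/
def relUnfold (t : ETerm σ) : SCtx σ → FTerm σ
  | hole => t.unfold
  | left S _ => relUnfold t S
  | right _ S => relUnfold t S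
  | es S u => (relUnfold t S).inst u.unfold

/-- A shallow context is applicative if it has the form `S'⟨L u⟩`. -/
def IsApplicative (S : SCtx σ) : Prop :=
  ∃ (S' L : SCtx σ) (u : ETerm σ), L.IsSubstitution ∧ S = S'.comp (left L u)

/-- Evaluable shallow contexts. -/
inductive IsEvaluable : SCtx σ → Prop
  | hole : IsEvaluable hole
  | left (S : SCtx σ) (t : ETerm σ) (hS : IsEvaluable S) (ht : t.unfold.IsFireball) :
      IsEvaluable (left S t)
  | right (t : ETerm σ) (S : SCtx σ) (hS : IsEvaluable S) : IsEvaluable (right t S)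
  | es (S : SCtx σ) (t : ETerm σ) (hS : IsEvaluable (S.inst t.unfold.embed))
      (ht : t.unfold.IsFireball) : IsEvaluable (es S t)

/-- A shallow context is useful if it is evaluable and applicative. -/
def IsUseful (S : SCtx σ) : Prop := S.IsEvaluable ∧ S.IsApplicative

end SCtx

/-- The two kinds of steps of a calculus with explicit substitutions: multiplicative steps (`mul`)
and exponential, i.e. substitution, steps (`exp`). -/
inductive Kind where
  | mul : Kind
  | exp : Kind
  deriving DecidableEq

/-- The useful strategy of the Useful Fireball Calculus.
* Multiplicative: `S⟨L⟨λx.t⟩ u⟩ ⊸ S⟨L⟨t[x ← u]⟩⟩`, if `S⟨L u⟩` is useful.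
* Exponential: `S⟨S'⟨x⟩[x ← L⟨u⟩]⟩ ⊸ S⟨L⟨S'⟨u⟩[x ← u]⟩⟩`, if `S⟨S'[x ← L⟨u⟩]⟩` is useful, `u` is
  not of the form `u'[y ← w]`, and `u` unfolds to a value relatively to `S⟨L⟩`.

The shifts and renamings express that `L` does not capture variables of the parts that enter its
scope, and that `S'` and `x` do not capture variables of `u`. -/
inductive UStep {σ : Type*} : Kind → ETerm σ → ETerm σ → Prop
  | mul (S L : SCtx σ) (t u : ETerm σ) (hL : L.IsSubstitution)
      (huse : (S.comp (.left L u)).IsUseful) :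
      UStep .mul (S.plug (.app (L.plug (.lam t)) u)) (S.plug (L.plug (.es t (u.shift L.depth))))
  | exp (S S' L : SCtx σ) (u : ETerm σ) (hL : L.IsSubstitution)
      (huse : (S.comp (.es S' (L.plug u))).IsUseful) (hu : ¬ u.IsES)
      (hval : (SCtx.relUnfold u (S.comp L)).IsValue) :
      UStep .exp (S.plug (.es (S'.plug (.var S'.depth)) (L.plug u)))
        (S.plug (L.plug (.es
          ((S'.rename (liftRen (· + L.depth))).plug (u.shift (S'.depth + 1))) u)))

/-! ### Derivations and high-level implementation systems -/

/-- `Steps R n t u`: there is an `R`-derivation of length `n` from `t` to `u`. -/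
inductive Steps {T : Type*} (R : T → T → Prop) : ℕ → T → T → Prop
  | nil (t : T) : Steps R 0 t t
  | cons {n : ℕ} {t r u : T} (h : R t r) (d : Steps R n r u) : Steps R (n + 1) t u

/-- `Derivation C ks t u`: there is a `C`-derivation from `t` to `u` whose successive steps have the
kinds listed in `ks`. Its length is `ks.length`, its numbers of multiplicative and
of exponential steps are `ks.count .mul` and `ks.count .exp`. -/
inductive Derivation {T : Type*} (C : Kind → T → T → Prop) : List Kind → T → T → Prop
  | nil (t : T) : Derivation C [] t t
  | cons {k : Kind} {ks : List Kind} {t r u : T} (h : C k t r) (d : Derivation C ks r u) :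
      Derivation C (k :: ks) t u

/-- Normal forms of a strategy. -/
def IsNormal {T : Type*} (R : T → T → Prop) (t : T) : Prop := ∀ u, ¬ R t u

/-- The term `t` reduces to a normal form. -/
def IsNormalising {T : Type*} (R : T → T → Prop) (t : T) : Prop :=
  ∃ (n : ℕ) (u : T), Steps R n t u ∧ IsNormal R u

/-- The union of the multiplicative and exponential steps of a strategy. -/
def anyKind {T : Type*} (C : Kind → T → T → Prop) (t u : T) : Prop := ∃ k, C k t u

/-- `(F, C)` is a high-level implementation system. -/
structure IsHighLevelImplementationSystem {σ : Type*}
    (F : FTerm σ → FTerm σ → Prop) (C : Kind → ETerm σ → ETerm σ → Prop) : Prop where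
  deterministic_left : ∀ t u₁ u₂, F t u₁ → F t u₂ → u₁ = u₂
  deterministic_right : ∀ t k₁ k₂ u₁ u₂, C k₁ t u₁ → C k₂ t u₂ → k₁ = k₂ ∧ u₁ = u₂
  normal_form : ∀ (t : FTerm σ) (ks : List Kind) (u : ETerm σ),
    Derivation C ks t.embed u → IsNormal (anyKind C) u → IsNormal F u.unfold
  projection : ∀ (t : FTerm σ) (ks : List Kind) (u : ETerm σ),
    Derivation C ks t.embed u → Steps F (ks.count .mul) t.embed.unfold u.unfold

/-- Local boundedness: after a derivation `d` from a λ-term, the length of any sequence of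
exponential steps is linear in the number of multiplicative steps of `d`. -/
def IsLocallyBounded {σ : Type*} (C : Kind → ETerm σ → ETerm σ → Prop) : Prop :=
  ∃ c : ℕ, ∀ (t : FTerm σ) (ks : List Kind) (u : ETerm σ), Derivation C ks t.embed u →
    ∀ (n : ℕ) (w : ETerm σ), Derivation C (List.replicate n .exp) u w → n ≤ c * ks.count .mul

/-- `C` implements `F` with quadratic overhead: `C`-derivations from λ-terms project
on `F`-derivations and every `F`-derivation is obtained in this way, the `C`-derivation being at
most quadratically longer than the `F`-derivation. -/
def ImplementsWithQuadraticOverhead {σ : Type*}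
    (F : FTerm σ → FTerm σ → Prop) (C : Kind → ETerm σ → ETerm σ → Prop) : Prop :=
  (∀ t : FTerm σ, IsNormalising F t ↔ IsNormalising (anyKind C) t.embed) ∧
  ∃ c : ℕ,
    (∀ (t : FTerm σ) (ks : List Kind) (u : ETerm σ), Derivation C ks t.embed u →
      ∃ h : ℕ, h = ks.count .mul ∧ Steps F h t u.unfold ∧ ks.length ≤ c * h ^ 2) ∧
    (∀ (t s : FTerm σ) (h : ℕ), Steps F h t s →
      ∃ (ks : List Kind) (u : ETerm σ), Derivation C ks t.embed u ∧ u.unfold = s ∧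
        ks.count .mul = h ∧ ks.length ≤ c * h ^ 2)

end FireballCalculus

open FireballCalculus

/-! Terms with explicit substitutions are read in an environment: `ETerm.eval` interprets variables
by FBC terms, and an explicit substitution merely extends the environment. Unfolding, relative
unfolding and evaluability thereby become structural recursions that commute with plugging.

A useful redex of either kind is a `Focus`: a useful context whose hole holds an abstraction or a
variable whose value is one. A term with a focus never unfolds to a fireball
(`Focus.not_isFireball`), whereas evaluability demands fireballs to the right of the hole. Hence the
focus is unique (`Focus.unique`), which gives determinism, kinds included.

Exponential steps preserve the unfolding and a multiplicative step projects on exactly one fireball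
step, so derivations project. Along derivations from λ-terms, explicit substitutions contain
fireballs and none occurs under an abstraction (`ETerm.Inv`). Under this invariant a redex of the
unfolding yields a focus (`exists_focus`), so normal forms unfold to normal forms, and fireball
derivations can be simulated.

For the cost, a multiplicative step creates one explicit substitution and an exponential step none,
because it copies only an abstraction or a variable. In a sequence of exponential steps each copied
variable is the next focus, and its binder lies strictly outside the previous one; so the sequence
is no longer than the number of explicit substitutions, that is, of past multiplicative steps.
Summing over the blocks between multiplicative steps gives the quadratic bound. -/

namespace FireballCalculus

/-! ### Substitution lemmas for the Fireball Calculus -/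

namespace FTerm

variable {σ : Type*}

/-- Extension of a parallel substitution by an image for index `0`. -/
def cons (u : FTerm σ) (τ : ℕ → FTerm σ) : ℕ → FTerm σ
  | 0 => u
  | n + 1 => τ n

@[simp] theorem cons_zero (u : FTerm σ) (τ : ℕ → FTerm σ) : cons u τ 0 = u := rfl

@[simp] theorem cons_succ (u : FTerm σ) (τ : ℕ → FTerm σ) (n : ℕ) : cons u τ (n + 1) = τ n := rfl

theorem cons_comp_liftRen (u : FTerm σ) (τ : ℕ → FTerm σ) (f : ℕ → ℕ) :
    cons u τ ∘ liftRen f = cons u (τ ∘ f) := by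
  funext n; cases n <;> rfl

theorem cons_comp_succ (u : FTerm σ) (τ : ℕ → FTerm σ) : cons u τ ∘ Nat.succ = τ := rfl

theorem rename_rename (t : FTerm σ) (f g : ℕ → ℕ) :
    (t.rename f).rename g = t.rename (g ∘ f) := by
  induction t generalizing f g with
  | lam t ih =>
    have : liftRen g ∘ liftRen f = liftRen (g ∘ f) := by funext n; cases n <;> rfl
    simp [rename, ih, this]
  | _ => simp_all [rename]

theorem subst_of_rename (t : FTerm σ) (f : ℕ → ℕ) (τ : ℕ → FTerm σ) :
    (t.rename f).subst τ = t.subst (τ ∘ f) := by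
  induction t generalizing f τ with
  | lam t ih =>
    have : liftSub τ ∘ liftRen f = liftSub (τ ∘ f) := by funext n; cases n <;> rfl
    simp [rename, subst, ih, this]
  | _ => simp_all [rename, subst]

theorem rename_subst (t : FTerm σ) (τ : ℕ → FTerm σ) (f : ℕ → ℕ) :
    (t.subst τ).rename f = t.subst (fun n => (τ n).rename f) := by
  induction t generalizing f τ with
  | lam t ih =>
    have : (fun n => (liftSub τ n).rename (liftRen f)) = liftSub (fun n => (τ n).rename f) := by
      funext n
      cases n with
      | zero => rfl
      | succ n =>
        simp only [liftSub, rename_rename]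
        rfl
    simp [rename, subst, ih, this]
  | _ => simp_all [rename, subst]

theorem subst_subst (t : FTerm σ) (τ ρ : ℕ → FTerm σ) :
    (t.subst τ).subst ρ = t.subst (fun n => (τ n).subst ρ) := by
  induction t generalizing τ ρ with
  | lam t ih =>
    have : (fun n => (liftSub τ n).subst (liftSub ρ)) = liftSub (fun n => (τ n).subst ρ) := by
      funext n
      cases n with
      | zero => rfl
      | succ n =>
        simp only [liftSub, subst_of_rename, rename_subst]
        rfl
    simp [subst, ih, this]
  | _ => simp_all [subst]

theorem subst_var (t : FTerm σ) : t.subst var = t := by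
  induction t with
  | lam t ih =>
    have : liftSub (var : ℕ → FTerm σ) = var := by funext n; cases n <;> rfl
    simp [subst, ih, this]
  | _ => simp_all [subst]

theorem inst_subst (t u : FTerm σ) (τ : ℕ → FTerm σ) :
    (t.inst u).subst τ = t.subst (cons (u.subst τ) τ) := by
  rw [inst, subst_subst]
  congr 1
  funext n; cases n <;> rfl

theorem subst_liftSub_inst (t u : FTerm σ) (τ : ℕ → FTerm σ) :
    (t.subst (liftSub τ)).inst u = t.subst (cons u τ) := by
  rw [inst, subst_subst]
  congr 1
  funext n
  cases n with
  | zero => rfl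
  | succ n =>
    simp only [liftSub, subst_of_rename, cons]
    exact subst_var _

theorem IsValue.isFireball {t : FTerm σ} (h : t.IsValue) : t.IsFireball := Or.inl h

theorem isFireball_app {t u : FTerm σ} : (app t u).IsFireball ↔ t.IsInert ∧ u.IsFireball := by
  simp [IsFireball, IsValue, IsInert]

theorem IsValue.not_isInert {t : FTerm σ} (h : t.IsValue) : ¬ t.IsInert := by
  cases t <;> simp_all [IsValue, IsInert]

end FTerm

/-! ### The fireball strategy -/

namespace FStep

variable {σ : Type*}

theorem root {t f : FTerm σ} (hf : f.IsFireball) : FStep (.app (.lam t) f) (t.inst f) :=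
  fire .hole t f trivial hf

theorem app_left {t t' f : FTerm σ} (h : FStep t t') (hf : f.IsFireball) :
    FStep (.app t f) (.app t' f) := by
  obtain ⟨E, s, g, hE, hg⟩ := h
  exact fire (.left E f) s g ⟨hE, hf⟩ hg

theorem app_right {t t' : FTerm σ} (u : FTerm σ) (h : FStep t t') :
    FStep (.app u t) (.app u t') := by
  obtain ⟨E, s, g, hE, hg⟩ := h
  exact fire (.right u E) s g hE hg

theorem exists_eq_app {t s : FTerm σ} (h : FStep t s) : ∃ a b, t = .app a b := by
  obtain ⟨E, s, g, hE, hg⟩ := h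
  cases E <;> simp [FCtx.plug]

theorem app_cases {a b s : FTerm σ} (h : FStep (.app a b) s) :
    (∃ b', FStep b b' ∧ s = .app a b') ∨ (b.IsFireball ∧ ∃ a', FStep a a' ∧ s = .app a' b) ∨
      (b.IsFireball ∧ ∃ r, a = .lam r ∧ s = r.inst b) := by
  generalize hx : FTerm.app a b = x at h
  obtain ⟨E, r, g, hE, hg⟩ := h
  cases E with
  | hole =>
    simp only [FCtx.plug, FTerm.app.injEq] at hx
    obtain ⟨rfl, rfl⟩ := hx
    exact .inr (.inr ⟨hg, r, rfl, rfl⟩)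
  | left E u =>
    simp only [FCtx.plug, FTerm.app.injEq] at hx
    obtain ⟨rfl, rfl⟩ := hx
    exact .inr (.inl ⟨hE.2, _, fire E r g hE.1 hg, rfl⟩)
  | right u E =>
    simp only [FCtx.plug, FTerm.app.injEq] at hx
    obtain ⟨rfl, rfl⟩ := hx
    exact .inl ⟨_, fire E r g hE hg, rfl⟩

end FStep

/-- Abstractions are not entered, and the left part of an inert application is inert, hence never an
abstraction. -/
theorem isNormal_of_isFireball {σ : Type*} {t : FTerm σ} (h : t.IsFireball) :
    IsNormal FStep t := by
  induction t with
  | app a b iha ihb =>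
    intro s hs
    rw [FTerm.isFireball_app] at h
    obtain ⟨b', hb, -⟩ | ⟨-, a', ha, -⟩ | ⟨-, r, rfl, -⟩ := hs.app_cases
    · exact ihb h.2 _ hb
    · exact iha (.inr h.1) _ ha
    · exact h.1
  | _ => intro s hs; obtain ⟨a, b, h⟩ := hs.exists_eq_app; cases h

/-- The three ways of reducing an application exclude each other: the last two need the argument to
be a fireball, hence normal, and an abstraction is normal too. -/
theorem FStep.deterministic {σ : Type*} {t s₁ s₂ : FTerm σ} (h₁ : FStep t s₁)
    (h₂ : FStep t s₂) : s₁ = s₂ := by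
  induction t generalizing s₁ s₂ with
  | app a b iha ihb =>
    have lam_normal (r : FTerm σ) : IsNormal FStep (.lam r) := isNormal_of_isFireball (.inl trivial)
    obtain ⟨b₁, hb₁, rfl⟩ | ⟨hb₁, a₁, ha₁, rfl⟩ | ⟨hb₁, r₁, rfl, rfl⟩ := h₁.app_cases <;>
    obtain ⟨b₂, hb₂, rfl⟩ | ⟨hb₂, a₂, ha₂, rfl⟩ | ⟨hb₂, r₂, hr, rfl⟩ := h₂.app_cases
    · rw [ihb hb₁ hb₂]
    · exact (isNormal_of_isFireball hb₂ _ hb₁).elim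
    · exact (isNormal_of_isFireball hb₂ _ hb₁).elim
    · exact (isNormal_of_isFireball hb₁ _ hb₂).elim
    · rw [iha ha₁ ha₂]
    · subst hr; exact (lam_normal _ _ ha₁).elim
    · exact (isNormal_of_isFireball hb₁ _ hb₂).elim
    · exact (lam_normal _ _ ha₂).elim
    · cases hr; rfl
  | _ => obtain ⟨a, b, h⟩ := h₁.exists_eq_app; cases h

/-! ### Unfolding in an environment -/

namespace ETerm

variable {σ : Type*}

/-- The unfolding of `t`, with the variables interpreted by the environment `τ`. -/
def eval (τ : ℕ → FTerm σ) (t : ETerm σ) : FTerm σ := t.unfold.subst τ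

@[simp] theorem eval_var (τ : ℕ → FTerm σ) (n : ℕ) : (var n).eval τ = τ n := rfl

@[simp] theorem eval_sym (τ : ℕ → FTerm σ) (a : σ) : (sym a).eval τ = .sym a := rfl

@[simp] theorem eval_lam (τ : ℕ → FTerm σ) (t : ETerm σ) :
    (lam t).eval τ = .lam (t.eval (FTerm.liftSub τ)) := rfl

@[simp] theorem eval_app (τ : ℕ → FTerm σ) (t u : ETerm σ) :
    (app t u).eval τ = .app (t.eval τ) (u.eval τ) := rfl

@[simp] theorem eval_es (τ : ℕ → FTerm σ) (t u : ETerm σ) :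
    (es t u).eval τ = t.eval (FTerm.cons (u.eval τ) τ) :=
  FTerm.inst_subst _ _ _

theorem eval_liftSub_inst (t : ETerm σ) (u : FTerm σ) (τ : ℕ → FTerm σ) :
    (t.eval (FTerm.liftSub τ)).inst u = t.eval (FTerm.cons u τ) :=
  FTerm.subst_liftSub_inst _ _ _

theorem eval_id (t : ETerm σ) : t.eval FTerm.var = t.unfold := FTerm.subst_var _

theorem eval_rename (t : ETerm σ) (f : ℕ → ℕ) (τ : ℕ → FTerm σ) :
    (t.rename f).eval τ = t.eval (τ ∘ f) := by
  induction t generalizing f τ with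
  | lam t ih =>
    have : FTerm.liftSub τ ∘ liftRen f = FTerm.liftSub (τ ∘ f) := by funext n; cases n <;> rfl
    simp [rename, ih, this]
  | es t u iht ihu => simp [rename, iht, ihu, FTerm.cons_comp_liftRen]
  | _ => simp_all [rename]

theorem eval_subst (t : ETerm σ) (ρ : ℕ → ETerm σ) (τ : ℕ → FTerm σ) :
    (t.subst ρ).eval τ = t.eval (fun n => (ρ n).eval τ) := by
  induction t generalizing ρ τ with
  | lam t ih =>
    have : (fun n => (liftSub ρ n).eval (FTerm.liftSub τ)) =
        FTerm.liftSub (fun n => (ρ n).eval τ) := by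
      funext n
      cases n with
      | zero => rfl
      | succ n =>
        simp only [liftSub, FTerm.liftSub, eval_rename]
        exact (FTerm.rename_subst _ _ _).symm
    simp [subst, ih, this]
  | es t u iht ihu =>
    have (v : FTerm σ) : (fun n => (liftSub ρ n).eval (FTerm.cons v τ)) =
        FTerm.cons v (fun n => (ρ n).eval τ) := by
      funext n
      cases n with
      | zero => rfl
      | succ n =>
        simp only [liftSub, eval_rename, FTerm.cons_comp_succ, FTerm.cons_succ]
    simp [subst, iht, ihu, this]
  | _ => simp_all [subst]

/-- Every term is an explicit-substitution-free head inside a substitution context. -/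
theorem exists_plug_not_isES (t : ETerm σ) :
    ∃ (L : SCtx σ) (u : ETerm σ), L.IsSubstitution ∧ t = L.plug u ∧ ¬ u.IsES := by
  induction t with
  | es t u iht _ =>
    obtain ⟨L, r, hL, rfl, hr⟩ := iht
    exact ⟨.es L u, r, hL, rfl, hr⟩
  | _ => exact ⟨.hole, _, trivial, rfl, id⟩

/-- The head of a focused redex: an abstraction or a variable. -/
def IsHead (r : ETerm σ) : Prop := (∃ s, r = lam s) ∨ ∃ n, r = var n

theorem IsHead.not_isES {r : ETerm σ} (h : r.IsHead) : ¬ r.IsES := by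
  obtain ⟨s, rfl⟩ | ⟨n, rfl⟩ := h <;> exact id

theorem isHead_of_isValue_eval {r : ETerm σ} {τ : ℕ → FTerm σ} (hr : ¬ r.IsES)
    (h : (r.eval τ).IsValue) : r.IsHead := by
  cases r with
  | var n => exact .inr ⟨n, rfl⟩
  | lam s => exact .inl ⟨s, rfl⟩
  | es t u => exact (hr trivial).elim
  | _ => exact h.elim

theorem IsHead.rename {r : ETerm σ} (h : r.IsHead) (f : ℕ → ℕ) : (r.rename f).IsHead := by
  obtain ⟨s, rfl⟩ | ⟨n, rfl⟩ := h
  · exact .inl ⟨_, rfl⟩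
  · exact .inr ⟨_, rfl⟩

end ETerm

/-! ### Contexts read in an environment -/

namespace SCtx

variable {σ : Type*}

/-- The environment at the hole of `S`, in an ambient environment `τ`. -/
def env : (ℕ → FTerm σ) → SCtx σ → ℕ → FTerm σ
  | τ, hole => τ
  | τ, left S _ => S.env τ
  | τ, right _ S => S.env τ
  | τ, es S t => S.env (FTerm.cons (t.eval τ) τ)

/-- The unfolding of `S` in the environment `τ`, with an unfolded term in the hole. -/
def fill : (ℕ → FTerm σ) → SCtx σ → FTerm σ → FTerm σ
  | _, hole, x => x
  | τ, left S t, x => .app (S.fill τ x) (t.eval τ)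
  | τ, right t S, x => .app (t.eval τ) (S.fill τ x)
  | τ, es S t, x => S.fill (FTerm.cons (t.eval τ) τ) x

/-- Evaluability of a context in an ambient environment. -/
def EvalUnder : (ℕ → FTerm σ) → SCtx σ → Prop
  | _, hole => True
  | τ, left S t => S.EvalUnder τ ∧ (t.eval τ).IsFireball
  | τ, right _ S => S.EvalUnder τ
  | τ, es S t => S.EvalUnder (FTerm.cons (t.eval τ) τ) ∧ (t.eval τ).IsFireball

theorem eval_plug (S : SCtx σ) (r : ETerm σ) (τ : ℕ → FTerm σ) :
    (S.plug r).eval τ = S.fill τ (r.eval (S.env τ)) := by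
  induction S generalizing τ <;> simp_all [plug, fill, env]

theorem IsSubstitution.fill_eq {L : SCtx σ} (hL : L.IsSubstitution) (τ : ℕ → FTerm σ)
    (x : FTerm σ) : L.fill τ x = x := by
  induction L generalizing τ with
  | hole => rfl
  | es L t ih => exact ih hL _
  | _ => exact hL.elim

theorem IsSubstitution.eval_plug {L : SCtx σ} (hL : L.IsSubstitution) (r : ETerm σ)
    (τ : ℕ → FTerm σ) : (L.plug r).eval τ = r.eval (L.env τ) := by
  rw [SCtx.eval_plug, hL.fill_eq]

theorem plug_comp (S S' : SCtx σ) (r : ETerm σ) : (S.comp S').plug r = S.plug (S'.plug r) := by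
  induction S <;> simp_all [plug, comp]

theorem comp_assoc (S S' S'' : SCtx σ) : (S.comp S').comp S'' = S.comp (S'.comp S'') := by
  induction S <;> simp_all [comp]

theorem env_comp (S S' : SCtx σ) (τ : ℕ → FTerm σ) : (S.comp S').env τ = S'.env (S.env τ) := by
  induction S generalizing τ <;> simp_all [env, comp]

theorem evalUnder_comp (S S' : SCtx σ) (τ : ℕ → FTerm σ) :
    (S.comp S').EvalUnder τ ↔ S.EvalUnder τ ∧ S'.EvalUnder (S.env τ) := by
  induction S generalizing τ <;> simp_all [env, comp, EvalUnder, and_right_comm]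

theorem depth_comp (S S' : SCtx σ) : (S.comp S').depth = S.depth + S'.depth := by
  induction S <;> simp_all [depth, comp]; omega

/-- Indices from `S.depth` on are those not bound by `S`, so shifting by the depth cancels the
effect of entering `S`. -/
theorem env_add_depth (S : SCtx σ) (τ : ℕ → FTerm σ) (n : ℕ) : S.env τ (n + S.depth) = τ n := by
  induction S generalizing τ n with
  | es S t ih => rw [env, depth, add_comm S.depth, ← add_assoc, ih]; rfl
  | hole => rfl
  | left S t ih => exact ih _ _
  | right t S ih => exact ih _ _

theorem env_comp_add_depth (S : SCtx σ) (τ : ℕ → FTerm σ) : S.env τ ∘ (· + S.depth) = τ :=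
  funext (S.env_add_depth τ)

/-- This is the shift applied to the copy made by an exponential step: it skips the binders of `S`
and the substituted variable. -/
theorem env_cons_comp_add (S : SCtx σ) (v : FTerm σ) (τ : ℕ → FTerm σ) :
    S.env (FTerm.cons v τ) ∘ (· + (S.depth + 1)) = τ := by
  funext n
  rw [Function.comp_apply, show n + (S.depth + 1) = n + 1 + S.depth by omega,
    SCtx.env_add_depth, FTerm.cons_succ]

theorem depth_rename (S : SCtx σ) (f : ℕ → ℕ) : (S.rename f).depth = S.depth := by
  induction S generalizing f <;> simp_all [depth, rename]

theorem fill_rename (S : SCtx σ) (f : ℕ → ℕ) (τ : ℕ → FTerm σ) (x : FTerm σ) :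
    (S.rename f).fill τ x = S.fill (τ ∘ f) x := by
  induction S generalizing f τ <;>
    simp_all [fill, rename, ETerm.eval_rename, FTerm.cons_comp_liftRen]

theorem evalUnder_rename (S : SCtx σ) (f : ℕ → ℕ) (τ : ℕ → FTerm σ) :
    (S.rename f).EvalUnder τ ↔ S.EvalUnder (τ ∘ f) := by
  induction S generalizing f τ <;>
    simp_all [EvalUnder, rename, ETerm.eval_rename, FTerm.cons_comp_liftRen]

theorem evalUnder_subst (S : SCtx σ) (ρ : ℕ → ETerm σ) (τ : ℕ → FTerm σ) :
    (S.subst ρ).EvalUnder τ ↔ S.EvalUnder (fun n => (ρ n).eval τ) := by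
  induction S generalizing ρ τ with
  | es S t ih =>
    have (v : FTerm σ) : (fun n => (ETerm.liftSub ρ n).eval (FTerm.cons v τ)) =
        FTerm.cons v (fun n => (ρ n).eval τ) := by
      funext n
      cases n with
      | zero => rfl
      | succ n =>
        simp only [ETerm.liftSub, ETerm.eval_rename, FTerm.cons_comp_succ, FTerm.cons_succ]
    simp [EvalUnder, subst, ih, ETerm.eval_subst, this]
  | _ => simp_all [EvalUnder, subst, ETerm.eval_subst]

theorem evalUnder_inst_embed (S : SCtx σ) (t : FTerm σ) :
    (S.inst t.embed).EvalUnder FTerm.var ↔ S.EvalUnder (FTerm.cons t FTerm.var) := by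
  rw [inst, evalUnder_subst]
  have : (fun n => (ETerm.single t.embed n).eval FTerm.var) = FTerm.cons t FTerm.var := by
    funext n
    cases n with
    | zero => simp [ETerm.single, ETerm.eval_id, FTerm.unfold_embed]
    | succ n => rfl
  rw [this]


/-- The number of frames of a context. -/
def length : SCtx σ → ℕ
  | hole => 0
  | left S _ => S.length + 1
  | right _ S => S.length + 1
  | es S _ => S.length + 1

theorem length_subst (S : SCtx σ) (ρ : ℕ → ETerm σ) : (S.subst ρ).length = S.length := by
  induction S generalizing ρ <;> simp_all [length, subst]

theorem IsEvaluable.evalUnder {S : SCtx σ} (h : S.IsEvaluable) : S.EvalUnder FTerm.var := by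
  induction h with
  | hole => trivial
  | left S t _ ht ih => exact ⟨ih, by rwa [ETerm.eval_id]⟩
  | right t S _ ih => exact ih
  | es S t _ ht ih =>
    rw [evalUnder_inst_embed] at ih
    rw [EvalUnder, ETerm.eval_id]
    exact ⟨ih, ht⟩

/-- The clause of `IsEvaluable` for `es` concerns an instance of the context, which is not a
subcontext but has as many frames; hence the induction on `length`. -/
theorem isEvaluable_of_evalUnder {S : SCtx σ} (h : S.EvalUnder FTerm.var) : S.IsEvaluable := by
  induction hn : S.length generalizing S with
  | zero => cases S <;> simp_all [length, IsEvaluable.hole]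
  | succ n ih =>
    cases S with
    | hole => exact .hole
    | left S t =>
      rw [EvalUnder, ETerm.eval_id] at h
      exact .left S t (ih h.1 (by simpa [length] using hn)) h.2
    | right t S => exact .right t S (ih h (by simpa [length] using hn))
    | es S t =>
      rw [EvalUnder, ETerm.eval_id] at h
      exact .es S t (ih ((evalUnder_inst_embed S _).2 h.1)
        (by simpa [length, inst, length_subst] using hn)) h.2

theorem relUnfold_eq_eval (S : SCtx σ) (t : ETerm σ) :
    relUnfold t S = t.eval (S.env FTerm.var) := by
  have (τ : ℕ → FTerm σ) : (relUnfold t S).subst τ = t.eval (S.env τ) := by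
    induction S generalizing τ with
    | es S u ih => rw [relUnfold, FTerm.inst_subst, ih]; rfl
    | hole => rfl
    | left S u ih => exact ih _
    | right u S ih => exact ih _
  rw [← this, FTerm.subst_var]

/-- An evaluable context unfolds to an evaluation context: its `es` frames vanish into the
environment and the arguments of its `left` frames unfold to fireballs. -/
theorem fstep_fill {S : SCtx σ} {τ : ℕ → FTerm σ} (hS : S.EvalUnder τ) {x y : FTerm σ}
    (h : FStep x y) : FStep (S.fill τ x) (S.fill τ y) := by
  induction S generalizing τ with
  | hole => exact h
  | left S t ih => exact (ih hS.1).app_left hS.2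
  | right t S ih => exact (ih hS).app_right _
  | es S t ih => exact ih hS.1

/-! ### Uniqueness of decompositions; applicative contexts -/

theorem plug_injective (S : SCtx σ) {r r' : ETerm σ} (h : S.plug r = S.plug r') : r = r' := by
  induction S <;> simp_all [plug]

theorem IsSubstitution.plug_unique {L L' : SCtx σ} {u u' : ETerm σ} (hL : L.IsSubstitution)
    (hL' : L'.IsSubstitution) (hu : ¬ u.IsES) (hu' : ¬ u'.IsES) (h : L.plug u = L'.plug u') :
    L = L' ∧ u = u' := by
  induction L generalizing L' with
  | hole =>
    cases L' with
    | hole => exact ⟨rfl, h⟩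
    | es L' t => simp only [plug] at h; subst h; exact (hu trivial).elim
    | _ => exact hL'.elim
  | es L t ih =>
    cases L' with
    | hole => simp only [plug] at h; subst h; exact (hu' trivial).elim
    | es L' t =>
      simp only [plug, ETerm.es.injEq] at h
      obtain ⟨rfl, rfl⟩ := ih (L' := L') hL hL' h.1
      simp [h.2]
    | _ => exact hL'.elim
  | _ => exact hL.elim

theorem not_isApplicative_hole : ¬ (hole : SCtx σ).IsApplicative := by
  rintro ⟨S, L, u, -, h⟩
  cases S <;> simp [comp] at h

theorem isApplicative_left {S : SCtx σ} {t : ETerm σ} :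
    (left S t).IsApplicative ↔ S.IsSubstitution ∨ S.IsApplicative := by
  constructor
  · rintro ⟨S', L, u, hL, h⟩
    cases S' with
    | hole => simp only [comp, left.injEq] at h; rw [h.1]; exact .inl hL
    | left S' v => simp only [comp, left.injEq] at h; exact .inr ⟨S', L, u, hL, h.1⟩
    | _ => simp [comp] at h
  · rintro (h | ⟨S', L, u, hL, rfl⟩)
    · exact ⟨hole, S, t, h, rfl⟩
    · exact ⟨left S' t, L, u, hL, rfl⟩

theorem isApplicative_right {S : SCtx σ} {t : ETerm σ} :
    (right t S).IsApplicative ↔ S.IsApplicative := by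
  constructor
  · rintro ⟨S', L, u, hL, h⟩
    cases S' with
    | right v S' => simp only [comp, right.injEq] at h; exact ⟨S', L, u, hL, h.2⟩
    | _ => simp [comp] at h
  · rintro ⟨S', L, u, hL, rfl⟩
    exact ⟨right t S', L, u, hL, rfl⟩

theorem isApplicative_es {S : SCtx σ} {t : ETerm σ} :
    (es S t).IsApplicative ↔ S.IsApplicative := by
  constructor
  · rintro ⟨S', L, u, hL, h⟩
    cases S' with
    | es S' v => simp only [comp, es.injEq] at h; exact ⟨S', L, u, hL, h.1⟩
    | _ => simp [comp] at h
  · rintro ⟨S', L, u, hL, rfl⟩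
    exact ⟨es S' t, L, u, hL, rfl⟩

theorem isSubstitution_rename (S : SCtx σ) (f : ℕ → ℕ) :
    (S.rename f).IsSubstitution ↔ S.IsSubstitution := by
  induction S generalizing f <;> simp_all [rename, IsSubstitution]

theorem isApplicative_rename (S : SCtx σ) (f : ℕ → ℕ) :
    (S.rename f).IsApplicative ↔ S.IsApplicative := by
  induction S generalizing f <;>
    simp_all [rename, isApplicative_left, isApplicative_right, isApplicative_es,
      isSubstitution_rename]

theorem IsSubstitution.isApplicative_comp {L : SCtx σ} (hL : L.IsSubstitution) (D : SCtx σ) :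
    (L.comp D).IsApplicative ↔ D.IsApplicative := by
  induction L with
  | hole => rfl
  | es L t ih => exact isApplicative_es.trans (ih hL)
  | _ => exact hL.elim

theorem IsSubstitution.isSubstitution_comp {L : SCtx σ} (hL : L.IsSubstitution) (D : SCtx σ) :
    (L.comp D).IsSubstitution ↔ D.IsSubstitution := by
  induction L with
  | hole => rfl
  | es L t ih => exact ih hL
  | _ => exact hL.elim

/-- Applicativity of `S⟨D⟩` only depends on the applicativity of `D` and on whether `D` is a
substitution context. -/
theorem IsApplicative.comp_congr {S D D' : SCtx σ}
    (hs : D.IsSubstitution → D'.IsSubstitution) (ha : D.IsApplicative → D'.IsApplicative)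
    (h : (S.comp D).IsApplicative) : (S.comp D').IsApplicative := by
  have hsub (T : SCtx σ) (hT : (T.comp D).IsSubstitution) : (T.comp D').IsSubstitution := by
    induction T with
    | hole => exact hs hT
    | es T t ih => exact ih hT
    | _ => exact hT.elim
  induction S with
  | hole => exact ha h
  | left S t ih =>
    exact isApplicative_left.2 ((isApplicative_left.1 h).imp (hsub S) ih)
  | right t S ih => exact isApplicative_right.2 (ih (isApplicative_right.1 h))
  | es S t ih => exact isApplicative_es.2 (ih (isApplicative_es.1 h))

theorem not_isSubstitution_comp_left (S D : SCtx σ) (t : ETerm σ) :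
    ¬ (S.comp (left D t)).IsSubstitution := by
  induction S <;> simp_all [comp, IsSubstitution]

/-- If the two distinguished `left` frames differed, the inner one would lie inside the substitution
context below the outer one. -/
theorem comp_left_unique {S S' L L' : SCtx σ} {u u' : ETerm σ} (hL : L.IsSubstitution)
    (hL' : L'.IsSubstitution) (h : S.comp (left L u) = S'.comp (left L' u')) :
    S = S' ∧ L = L' ∧ u = u' := by
  induction S generalizing S' with
  | hole =>
    cases S' with
    | hole => simpa [comp] using h
    | left S' t =>
      simp only [comp, left.injEq] at h
      rw [h.1] at hL
      exact (not_isSubstitution_comp_left _ _ _ hL).elim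
    | _ => simp [comp] at h
  | left S t ih =>
    cases S' with
    | hole =>
      simp only [comp, left.injEq] at h
      rw [← h.1] at hL'
      exact (not_isSubstitution_comp_left _ _ _ hL').elim
    | left S' t' =>
      simp only [comp, left.injEq] at h
      simpa [h.2] using ih h.1
    | _ => simp [comp] at h
  | right t S ih =>
    cases S' with
    | right t' S' =>
      simp only [comp, right.injEq] at h
      simpa [h.1] using ih h.2
    | _ => simp [comp] at h
  | es S t ih =>
    cases S' with
    | es S' t' =>
      simp only [comp, es.injEq] at h
      simpa [h.2] using ih h.1
    | _ => simp [comp] at h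

/-- The number of binders between an `es` frame and the hole singles out that frame. -/
theorem comp_es_unique {S S' D D' : SCtx σ} {u u' : ETerm σ} (hd : D.depth = D'.depth)
    (h : S.comp (es D u) = S'.comp (es D' u')) : S = S' ∧ D = D' ∧ u = u' := by
  induction S generalizing S' with
  | hole =>
    cases S' with
    | hole => simpa [comp] using h
    | es S' t =>
      simp only [comp, es.injEq] at h
      rw [h.1, depth_comp, depth] at hd
      omega
    | _ => simp [comp] at h
  | left S t ih =>
    cases S' with
    | left S' t' =>
      simp only [comp, left.injEq] at h
      simpa [h.2] using ih h.1
    | _ => simp [comp] at h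
  | right t S ih =>
    cases S' with
    | right t' S' =>
      simp only [comp, right.injEq] at h
      simpa [h.1] using ih h.2
    | _ => simp [comp] at h
  | es S t ih =>
    cases S' with
    | hole =>
      simp only [comp, es.injEq] at h
      rw [← h.1, depth_comp, depth] at hd
      omega
    | es S' t' =>
      simp only [comp, es.injEq] at h
      simpa [h.2] using ih h.1
    | _ => simp [comp] at h

/-- The binder of an index smaller than the depth of a context. -/
theorem exists_binder (C : SCtx σ) {n : ℕ} (hn : n < C.depth) :
    ∃ (S D : SCtx σ) (c : ETerm σ), C = S.comp (es D c) ∧ D.depth = n := by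
  induction C with
  | hole => exact (Nat.not_lt_zero _ hn).elim
  | left S t ih => obtain ⟨T, D, c, rfl, h⟩ := ih hn; exact ⟨left T t, D, c, rfl, h⟩
  | right t S ih => obtain ⟨T, D, c, rfl, h⟩ := ih hn; exact ⟨right t T, D, c, rfl, h⟩
  | es S t ih =>
    obtain hn | rfl := Nat.lt_succ_iff_lt_or_eq.1 hn
    · obtain ⟨T, D, c, rfl, h⟩ := ih hn; exact ⟨es T t, D, c, rfl, h⟩
    · exact ⟨hole, S, t, rfl, rfl⟩

theorem env_binder (S D : SCtx σ) (c : ETerm σ) (τ : ℕ → FTerm σ) :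
    (S.comp (es D c)).env τ D.depth = c.eval (S.env τ) := by
  rw [env_comp, env]
  simpa using D.env_add_depth (FTerm.cons (c.eval (S.env τ)) (S.env τ)) 0

/-- A variable free in the whole term unfolds to a variable, not to an abstraction. -/
theorem lt_depth_of_isValue_env {C : SCtx σ} {n : ℕ} (h : (C.env FTerm.var n).IsValue) :
    n < C.depth := by
  by_contra hn
  obtain ⟨k, rfl⟩ := Nat.exists_eq_add_of_le' (not_lt.1 hn)
  rw [env_add_depth] at h
  exact h

end SCtx

/-! ### Focused redexes -/

/-- `C⟨r⟩` is a decomposition of `t` exhibiting a redex of the useful strategy: `C` is useful and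
`r` is an abstraction, or a variable unfolding to one. -/
structure Focus {σ : Type*} (τ : ℕ → FTerm σ) (t : ETerm σ) (C : SCtx σ) (r : ETerm σ) : Prop where
  plug_eq : C.plug r = t
  evalUnder : C.EvalUnder τ
  isApplicative : C.IsApplicative
  isHead : r.IsHead
  isValue : (r.eval (C.env τ)).IsValue

namespace SCtx

variable {σ : Type*}

/-- Applicativity puts the value at the head of an application, which is therefore not inert; every
enclosing application then has a component that is not a fireball. -/
theorem not_isFireball_fill {C : SCtx σ} {τ : ℕ → FTerm σ} {x : FTerm σ}
    (hC : C.IsApplicative) (hx : x.IsValue) : ¬ (C.fill τ x).IsFireball := by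
  induction C generalizing τ with
  | hole => exact (not_isApplicative_hole hC).elim
  | left S t ih =>
    rw [fill, FTerm.isFireball_app]
    rintro ⟨h, -⟩
    obtain hS | hS := isApplicative_left.1 hC
    · rw [hS.fill_eq] at h
      exact hx.not_isInert h
    · exact ih hS (.inr h)
  | right t S ih =>
    rw [fill, FTerm.isFireball_app]
    exact fun h => ih (isApplicative_right.1 hC) h.2
  | es S t ih => exact ih (isApplicative_es.1 hC)

end SCtx

theorem Focus.not_isFireball {σ : Type*} {τ : ℕ → FTerm σ} {t : ETerm σ} {C : SCtx σ}
    {r : ETerm σ} (h : Focus τ t C r) : ¬ (t.eval τ).IsFireball := by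
  rw [← h.plug_eq, SCtx.eval_plug]
  exact SCtx.not_isFireball_fill h.isApplicative h.isValue

/-- Two contexts cannot part at an application: the one going left needs the argument to unfold to a
fireball, while the one going right puts a focus in it. -/
theorem Focus.unique_ctx {σ : Type*} {τ : ℕ → FTerm σ} {t : ETerm σ} {C C' : SCtx σ}
    {r r' : ETerm σ} (h : Focus τ t C r) (h' : Focus τ t C' r') : C = C' := by
  induction C generalizing τ t C' with
  | hole => exact (SCtx.not_isApplicative_hole h.isApplicative).elim
  | left S u ih =>
    cases C' with
    | hole => exact (SCtx.not_isApplicative_hole h'.isApplicative).elim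
    | left S' u' =>
      have e := h.plug_eq.trans h'.plug_eq.symm
      simp only [SCtx.plug, ETerm.app.injEq] at e
      obtain ⟨e, rfl⟩ := e
      -- The focus is either the value applied by this very application or strictly inside the left
      -- subterm. In the mixed cases that subterm would unfold to a value and also contain a focus.
      obtain hS | hS := SCtx.isApplicative_left.1 h.isApplicative <;>
      obtain hS' | hS' := SCtx.isApplicative_left.1 h'.isApplicative
      · rw [(hS.plug_unique hS' h.isHead.not_isES h'.isHead.not_isES e).1]
      · have F' : Focus τ (S'.plug r') S' r' := ⟨rfl, h'.evalUnder.1, hS', h'.isHead, h'.isValue⟩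
        refine (F'.not_isFireball ?_).elim
        rw [← e, hS.eval_plug]
        exact h.isValue.isFireball
      · have F : Focus τ (S.plug r) S r := ⟨rfl, h.evalUnder.1, hS, h.isHead, h.isValue⟩
        refine (F.not_isFireball ?_).elim
        rw [e, hS'.eval_plug]
        exact h'.isValue.isFireball
      · rw [ih (τ := τ) ⟨rfl, h.evalUnder.1, hS, h.isHead, h.isValue⟩
          ⟨e.symm, h'.evalUnder.1, hS', h'.isHead, h'.isValue⟩]
    | right u' S' =>
      have e := h.plug_eq.trans h'.plug_eq.symm
      simp only [SCtx.plug, ETerm.app.injEq] at e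
      have F' : Focus τ u S' r' := ⟨e.2.symm, h'.evalUnder,
        SCtx.isApplicative_right.1 h'.isApplicative, h'.isHead, h'.isValue⟩
      exact (F'.not_isFireball h.evalUnder.2).elim
    | es S' u' => simpa [SCtx.plug] using h.plug_eq.trans h'.plug_eq.symm
  | right u S ih =>
    have F : Focus τ (S.plug r) S r := ⟨rfl, h.evalUnder,
      SCtx.isApplicative_right.1 h.isApplicative, h.isHead, h.isValue⟩
    cases C' with
    | hole => exact (SCtx.not_isApplicative_hole h'.isApplicative).elim
    | left S' u' =>
      have e := h.plug_eq.trans h'.plug_eq.symm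
      simp only [SCtx.plug, ETerm.app.injEq] at e
      rw [e.2] at F
      exact (F.not_isFireball h'.evalUnder.2).elim
    | right u' S' =>
      have e := h.plug_eq.trans h'.plug_eq.symm
      simp only [SCtx.plug, ETerm.app.injEq] at e
      rw [e.1, ih F ⟨e.2.symm, h'.evalUnder,
        SCtx.isApplicative_right.1 h'.isApplicative, h'.isHead, h'.isValue⟩]
    | es S' u' => simpa [SCtx.plug] using h.plug_eq.trans h'.plug_eq.symm
  | es S u ih =>
    cases C' with
    | hole => exact (SCtx.not_isApplicative_hole h'.isApplicative).elim
    | es S' u' =>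
      have e := h.plug_eq.trans h'.plug_eq.symm
      simp only [SCtx.plug, ETerm.es.injEq] at e
      obtain ⟨e, rfl⟩ := e
      rw [ih (τ := FTerm.cons (u.eval τ) τ)
        ⟨rfl, h.evalUnder.1, SCtx.isApplicative_es.1 h.isApplicative, h.isHead, h.isValue⟩
        ⟨e.symm, h'.evalUnder.1, SCtx.isApplicative_es.1 h'.isApplicative, h'.isHead, h'.isValue⟩]
    | _ => simpa [SCtx.plug] using h.plug_eq.trans h'.plug_eq.symm

theorem Focus.unique {σ : Type*} {τ : ℕ → FTerm σ} {t : ETerm σ} {C C' : SCtx σ}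
    {r r' : ETerm σ} (h : Focus τ t C r) (h' : Focus τ t C' r') : C = C' ∧ r = r' := by
  obtain rfl := h.unique_ctx h'
  exact ⟨rfl, C.plug_injective (h.plug_eq.trans h'.plug_eq.symm)⟩

/-! ### Steps of the useful strategy as focused redexes -/

section

variable {σ : Type*}

theorem focus_mul {S L : SCtx σ} {t u : ETerm σ}
    (huse : (S.comp (.left L u)).IsUseful) :
    Focus FTerm.var (S.plug (.app (L.plug (.lam t)) u)) (S.comp (.left L u)) (.lam t) :=
  ⟨SCtx.plug_comp _ _ _, huse.1.evalUnder, huse.2, .inl ⟨t, rfl⟩, trivial⟩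

theorem focus_exp {S S' L : SCtx σ} {u : ETerm σ} (hL : L.IsSubstitution)
    (huse : (S.comp (.es S' (L.plug u))).IsUseful)
    (hval : (SCtx.relUnfold u (S.comp L)).IsValue) :
    Focus FTerm.var (S.plug (.es (S'.plug (.var S'.depth)) (L.plug u)))
      (S.comp (.es S' (L.plug u))) (.var S'.depth) := by
  refine ⟨SCtx.plug_comp _ _ _, huse.1.evalUnder, huse.2, .inr ⟨_, rfl⟩, ?_⟩
  rw [SCtx.relUnfold_eq_eval, SCtx.env_comp] at hval
  rwa [ETerm.eval_var, SCtx.env_binder, hL.eval_plug]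

/-- A focus on an abstraction gives a multiplicative step. -/
theorem Focus.exists_mul {t s : ETerm σ} {C : SCtx σ} (h : Focus FTerm.var t C (.lam s)) :
    ∃ t', UStep .mul t t' := by
  obtain ⟨S, L, u, hL, rfl⟩ := h.isApplicative
  have := UStep.mul S L s u hL ⟨SCtx.isEvaluable_of_evalUnder h.evalUnder, h.isApplicative⟩
  rw [← h.plug_eq, SCtx.plug_comp]
  exact ⟨_, this⟩

/-- A focus on a variable gives an exponential step. -/
theorem Focus.exists_exp {t : ETerm σ} {C : SCtx σ} {n : ℕ}
    (h : Focus FTerm.var t C (.var n)) : ∃ t', UStep .exp t t' := by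
  obtain ⟨S, S', c, rfl, rfl⟩ := C.exists_binder (SCtx.lt_depth_of_isValue_env h.isValue)
  obtain ⟨L, u, hL, rfl, hu⟩ := c.exists_plug_not_isES
  have hval := h.isValue
  rw [ETerm.eval_var, SCtx.env_binder, hL.eval_plug, ← SCtx.env_comp,
    ← SCtx.relUnfold_eq_eval] at hval
  have := UStep.exp S S' L u hL
    ⟨SCtx.isEvaluable_of_evalUnder h.evalUnder, h.isApplicative⟩ hu hval
  rw [← h.plug_eq, SCtx.plug_comp]
  exact ⟨_, this⟩

theorem UStep.deterministic {t u₁ u₂ : ETerm σ} {k₁ k₂ : Kind} (h₁ : UStep k₁ t u₁)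
    (h₂ : UStep k₂ t u₂) : k₁ = k₂ ∧ u₁ = u₂ := by
  cases h₁ with
  | mul S L r v hL huse =>
    have F := focus_mul (t := r) huse
    generalize hx : S.plug (.app (L.plug (.lam r)) v) = x at h₂ F
    cases h₂ with
    | mul S' L' r' v' hL' huse' =>
      obtain ⟨hC, hr⟩ := F.unique (focus_mul huse')
      obtain ⟨rfl, rfl, rfl⟩ := SCtx.comp_left_unique hL hL' hC
      cases hr
      exact ⟨rfl, rfl⟩
    | exp S' D L' v' hL' huse' hu' hval' =>
      cases (F.unique (focus_exp hL' huse' hval')).2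
  | exp S D L v hL huse hu hval =>
    have F := focus_exp hL huse hval
    generalize hx : S.plug (.es (D.plug (.var D.depth)) (L.plug v)) = x at h₂ F
    cases h₂ with
    | mul S' L' r' v' hL' huse' => cases (F.unique (focus_mul huse')).2
    | exp S' D' L' v' hL' huse' hu' hval' =>
      obtain ⟨hC, hr⟩ := F.unique (focus_exp hL' huse' hval')
      simp only [ETerm.var.injEq] at hr
      obtain ⟨rfl, rfl, hc⟩ := SCtx.comp_es_unique hr hC
      obtain ⟨rfl, rfl⟩ := hL.plug_unique hL' hu hu' hc
      exact ⟨rfl, rfl⟩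

/-! ### Projection -/

/-- Both the replaced variable and the shifted copy of `u` evaluate to the value of `u` under `L`,
and the renaming of `S'` undoes the entries that `L` adds to the environment. -/
theorem eval_exp_eq (S' L : SCtx σ) (u : ETerm σ) (hL : L.IsSubstitution) (τ : ℕ → FTerm σ) :
    (L.plug (.es ((S'.rename (liftRen (· + L.depth))).plug (u.shift (S'.depth + 1))) u)).eval τ =
      (ETerm.es (S'.plug (.var S'.depth)) (L.plug u)).eval τ := by
  set v := u.eval (L.env τ) with hv
  have h₁ : S'.env (FTerm.cons v τ) S'.depth = v := by
    simpa using S'.env_add_depth (FTerm.cons v τ) 0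
  have h₃ := (S'.rename (liftRen (· + L.depth))).env_cons_comp_add v (L.env τ)
  rw [SCtx.depth_rename] at h₃
  rw [hL.eval_plug, ETerm.eval_es, ETerm.eval_es, hL.eval_plug, ← hv, SCtx.eval_plug,
    SCtx.eval_plug, SCtx.fill_rename, FTerm.cons_comp_liftRen, SCtx.env_comp_add_depth,
    ETerm.eval_var, h₁, ETerm.shift, ETerm.eval_rename, h₃]

theorem UStep.unfold_eq {t t' : ETerm σ} (h : UStep .exp t t') : t.unfold = t'.unfold := by
  cases h with
  | exp S S' L u hL huse hu hval =>
    rw [← ETerm.eval_id, ← ETerm.eval_id, SCtx.eval_plug, SCtx.eval_plug, eval_exp_eq _ _ _ hL]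

/-- Evaluability of the frame holding `u` makes its unfolding a fireball, so the unfolded redex
fires at the root. -/
theorem UStep.fstep_unfold {t t' : ETerm σ} (h : UStep .mul t t') : FStep t.unfold t'.unfold := by
  cases h with
  | mul S L s u hL huse =>
    rw [← ETerm.eval_id, ← ETerm.eval_id, SCtx.eval_plug, SCtx.eval_plug]
    have hev := (SCtx.evalUnder_comp _ _ _).1 huse.1.evalUnder
    refine SCtx.fstep_fill hev.1 ?_
    rw [hL.eval_plug, ETerm.eval_es, ETerm.eval_app, hL.eval_plug, ETerm.eval_lam, ETerm.shift,
      ETerm.eval_rename, SCtx.env_comp_add_depth, ← ETerm.eval_liftSub_inst]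
    exact FStep.root hev.2.2

theorem Derivation.steps_unfold {ks : List Kind} {t u : ETerm σ} (d : Derivation UStep ks t u) :
    Steps FStep (ks.count .mul) t.unfold u.unfold := by
  induction d with
  | nil t => exact .nil _
  | @cons k ks t r u h d ih =>
    cases k with
    | mul => simpa using Steps.cons h.fstep_unfold ih
    | exp => rw [h.unfold_eq]; simpa using ih

end

/-! ### Invariants of derivations from λ-terms -/

namespace ETerm

variable {σ : Type*}

/-- The number of explicit substitutions outside abstractions. -/
def esCount : ETerm σ → ℕ
  | var _ => 0
  | sym _ => 0
  | lam _ => 0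
  | app t u => t.esCount + u.esCount
  | es t u => t.esCount + u.esCount + 1

/-- The term contains no explicit substitution. -/
def IsPure : ETerm σ → Prop
  | var _ => True
  | sym _ => True
  | lam t => t.IsPure
  | app t u => t.IsPure ∧ u.IsPure
  | es _ _ => False

/-- In the environment `τ`, explicit substitutions contain fireballs, and none of them occurs under
an abstraction. -/
def Inv : (ℕ → FTerm σ) → ETerm σ → Prop
  | _, var _ => True
  | _, sym _ => True
  | _, lam t => t.IsPure
  | τ, app t u => t.Inv τ ∧ u.Inv τ
  | τ, es t u => t.Inv (FTerm.cons (u.eval τ) τ) ∧ u.Inv τ ∧ (u.eval τ).IsFireball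

theorem isPure_rename (t : ETerm σ) (f : ℕ → ℕ) : (t.rename f).IsPure ↔ t.IsPure := by
  induction t generalizing f <;> simp_all [rename, IsPure]

theorem inv_rename (t : ETerm σ) (f : ℕ → ℕ) (τ : ℕ → FTerm σ) :
    (t.rename f).Inv τ ↔ t.Inv (τ ∘ f) := by
  induction t generalizing f τ <;>
    simp_all [rename, Inv, isPure_rename, eval_rename, FTerm.cons_comp_liftRen]

theorem esCount_rename (t : ETerm σ) (f : ℕ → ℕ) : (t.rename f).esCount = t.esCount := by
  induction t generalizing f <;> simp_all [rename, esCount]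

theorem IsPure.inv {t : ETerm σ} (h : t.IsPure) (τ : ℕ → FTerm σ) : t.Inv τ := by
  induction t generalizing τ <;> simp_all [IsPure, Inv]

theorem IsPure.esCount_eq {t : ETerm σ} (h : t.IsPure) : t.esCount = 0 := by
  induction t <;> simp_all [IsPure, esCount]

theorem isPure_embed (t : FTerm σ) : t.embed.IsPure := by
  induction t <;> simp_all [FTerm.embed, IsPure]

theorem IsHead.esCount_eq {r : ETerm σ} (h : r.IsHead) : r.esCount = 0 := by
  obtain ⟨s, rfl⟩ | ⟨n, rfl⟩ := h <;> rfl

end ETerm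

namespace SCtx

variable {σ : Type*}

/-- The number of explicit substitutions of a context, outside abstractions. -/
def esCount : SCtx σ → ℕ
  | hole => 0
  | left S t => S.esCount + t.esCount
  | right t S => S.esCount + t.esCount
  | es S t => S.esCount + t.esCount + 1

/-- The invariant of contexts corresponding to `ETerm.Inv`. -/
def Inv : (ℕ → FTerm σ) → SCtx σ → Prop
  | _, hole => True
  | τ, left S t => S.Inv τ ∧ t.Inv τ
  | τ, right t S => S.Inv τ ∧ t.Inv τ
  | τ, es S t => S.Inv (FTerm.cons (t.eval τ) τ) ∧ t.Inv τ ∧ (t.eval τ).IsFireball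

theorem esCount_plug (S : SCtx σ) (r : ETerm σ) :
    (S.plug r).esCount = S.esCount + r.esCount := by
  induction S <;> simp_all [plug, esCount, ETerm.esCount] <;> omega

theorem esCount_comp (S S' : SCtx σ) : (S.comp S').esCount = S.esCount + S'.esCount := by
  induction S <;> simp_all [comp, esCount] <;> omega

theorem esCount_rename (S : SCtx σ) (f : ℕ → ℕ) : (S.rename f).esCount = S.esCount := by
  induction S generalizing f <;> simp_all [rename, esCount, ETerm.esCount_rename]

theorem inv_plug (S : SCtx σ) (r : ETerm σ) (τ : ℕ → FTerm σ) :
    (S.plug r).Inv τ ↔ S.Inv τ ∧ r.Inv (S.env τ) := by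
  induction S generalizing τ <;> simp_all [plug, Inv, ETerm.Inv, env] <;> tauto

theorem inv_rename (S : SCtx σ) (f : ℕ → ℕ) (τ : ℕ → FTerm σ) :
    (S.rename f).Inv τ ↔ S.Inv (τ ∘ f) := by
  induction S generalizing f τ <;>
    simp_all [rename, Inv, ETerm.inv_rename, ETerm.eval_rename, FTerm.cons_comp_liftRen]

theorem IsSubstitution.evalUnder {L : SCtx σ} (hL : L.IsSubstitution) {τ : ℕ → FTerm σ}
    (h : L.Inv τ) : L.EvalUnder τ := by
  induction L generalizing τ with
  | hole => trivial
  | es L t ih => exact ⟨ih hL h.1, h.2.2⟩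
  | _ => exact hL.elim

end SCtx

section

variable {σ : Type*}

/-- A multiplicative step exposes a pure body and creates a substitution whose content is a fireball
by evaluability. In an exponential step `u`, under `L`, has the same value as `L⟨u⟩`, already known
to be a fireball. -/
theorem UStep.inv {k : Kind} {t t' : ETerm σ} (h : UStep k t t') (ht : t.Inv FTerm.var) :
    t'.Inv FTerm.var := by
  cases h with
  | mul S L s u hL huse =>
    have hev := (SCtx.evalUnder_comp _ _ _).1 huse.1.evalUnder
    rw [SCtx.inv_plug, ETerm.Inv, SCtx.inv_plug] at ht
    obtain ⟨hS, ⟨hL', hs⟩, hu⟩ := ht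
    rw [SCtx.inv_plug, SCtx.inv_plug, ETerm.Inv, ETerm.shift, ETerm.inv_rename,
      ETerm.eval_rename, SCtx.env_comp_add_depth]
    exact ⟨hS, hL', ETerm.IsPure.inv hs _, hu, hev.2.2⟩
  | exp S S' L u hL huse hu hval =>
    rw [SCtx.inv_plug, ETerm.Inv, SCtx.inv_plug, SCtx.inv_plug, hL.eval_plug] at ht
    obtain ⟨hS, ⟨hS', -⟩, ⟨hL', hu⟩, hf⟩ := ht
    have h₃ := (S'.rename (liftRen (· + L.depth))).env_cons_comp_add
      (u.eval (L.env (S.env FTerm.var))) (L.env (S.env FTerm.var))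
    rw [SCtx.depth_rename] at h₃
    rw [SCtx.inv_plug, SCtx.inv_plug, ETerm.Inv, SCtx.inv_plug, SCtx.inv_rename,
      FTerm.cons_comp_liftRen, SCtx.env_comp_add_depth, ETerm.shift, ETerm.inv_rename, h₃]
    exact ⟨hS, hL', ⟨hS', hu⟩, hu, hf⟩

theorem UStep.esCount_mul {t t' : ETerm σ} (h : UStep .mul t t') (ht : t.Inv FTerm.var) :
    t'.esCount = t.esCount + 1 := by
  cases h with
  | mul S L s u hL huse =>
    rw [SCtx.inv_plug, ETerm.Inv, SCtx.inv_plug] at ht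
    have hs : s.esCount = 0 := ETerm.IsPure.esCount_eq ht.2.1.2
    simp only [SCtx.esCount_plug, ETerm.esCount, ETerm.shift, ETerm.esCount_rename, hs]
    omega

/-- The head of the substituted term in an exponential step. -/
theorem isHead_of_exp {S L : SCtx σ} {u : ETerm σ} (hu : ¬ u.IsES)
    (hval : (SCtx.relUnfold u (S.comp L)).IsValue) : u.IsHead := by
  rw [SCtx.relUnfold_eq_eval] at hval
  exact ETerm.isHead_of_isValue_eval hu hval

/-- The duplicated term is an abstraction or a variable, and neither contributes to `esCount`. -/
theorem UStep.esCount_exp {t t' : ETerm σ} (h : UStep .exp t t') :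
    t'.esCount = t.esCount := by
  cases h with
  | exp S S' L u hL huse hu hval =>
    have := (isHead_of_exp hu hval).esCount_eq
    simp only [SCtx.esCount_plug, ETerm.esCount, ETerm.shift, ETerm.esCount_rename,
      SCtx.esCount_rename, this]
    omega

theorem Derivation.inv_and_esCount {ks : List Kind} {t u : ETerm σ} (d : Derivation UStep ks t u)
    (ht : t.Inv FTerm.var) :
    u.Inv FTerm.var ∧ u.esCount = t.esCount + ks.count .mul := by
  induction d with
  | nil t => exact ⟨ht, rfl⟩
  | @cons k ks t r u h d ih =>
    obtain ⟨h₁, h₂⟩ := ih (h.inv ht)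
    refine ⟨h₁, ?_⟩
    cases k with
    | mul => simp [h₂, h.esCount_mul ht]; omega
    | exp => simp [h₂, h.esCount_exp]

/-! ### Local boundedness -/

/-- The focus after an exponential step. -/
theorem focus_after_exp {S S' L : SCtx σ} {u : ETerm σ} (hL : L.IsSubstitution)
    (huse : (S.comp (.es S' (L.plug u))).IsUseful) (hu : ¬ u.IsES)
    (hval : (SCtx.relUnfold u (S.comp L)).IsValue) (hinv : L.Inv (S.env FTerm.var)) :
    Focus FTerm.var
      (S.plug (L.plug (.es ((S'.rename (liftRen (· + L.depth))).plug (u.shift (S'.depth + 1))) u)))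
      ((S.comp L).comp (.es (S'.rename (liftRen (· + L.depth))) u)) (u.shift (S'.depth + 1)) := by
  have hhead := isHead_of_exp hu hval
  have hev := (SCtx.evalUnder_comp _ _ _).1 huse.1.evalUnder
  refine ⟨by simp only [SCtx.plug_comp, SCtx.plug], ?_, ?_, hhead.rename _, ?_⟩
  -- The frames of `L` now surround the hole; the invariant says that they contain fireballs.
  · rw [SCtx.evalUnder_comp, SCtx.evalUnder_comp]
    have h := hev.2
    rw [SCtx.EvalUnder, hL.eval_plug] at h
    refine ⟨⟨hev.1, hL.evalUnder hinv⟩, ?_⟩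
    rw [SCtx.EvalUnder, SCtx.env_comp, SCtx.evalUnder_rename, FTerm.cons_comp_liftRen,
      SCtx.env_comp_add_depth]
    exact h
  · rw [SCtx.comp_assoc]
    refine huse.2.comp_congr (fun h => ?_) (fun h => ?_)
    · exact (hL.isSubstitution_comp _).2 ((SCtx.isSubstitution_rename _ _).2 h)
    · exact (hL.isApplicative_comp _).2 (SCtx.isApplicative_es.2
        ((SCtx.isApplicative_rename _ _).2 (SCtx.isApplicative_es.1 h)))
  · have h₃ := (S'.rename (liftRen (· + L.depth))).env_cons_comp_add
      (u.eval ((S.comp L).env FTerm.var)) ((S.comp L).env FTerm.var)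
    rw [SCtx.depth_rename] at h₃
    rw [SCtx.env_comp, SCtx.env, ETerm.shift, ETerm.eval_rename, h₃, ← SCtx.relUnfold_eq_eval]
    exact hval

/-- Consecutive exponential steps replace binders which lie further and further outside. -/
theorem Derivation.exp_le_esCount {n : ℕ} {t w : ETerm σ}
    (d : Derivation UStep (List.replicate n .exp) t w) (ht : t.Inv FTerm.var) {S D : SCtx σ}
    {c : ETerm σ} (hF : Focus FTerm.var t (S.comp (.es D c)) (.var D.depth)) :
    n ≤ S.esCount + c.esCount + 1 := by
  induction n generalizing t S D c with
  | zero => omega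
  | succ n ih =>
    rw [List.replicate_succ] at d
    obtain _ | ⟨h, d⟩ := d
    have hinv := h.inv ht
    cases h with
    | exp S₁ D₁ L u hL huse hu hval =>
      obtain ⟨hC, hr⟩ := hF.unique (focus_exp hL huse hval)
      simp only [ETerm.var.injEq] at hr
      obtain ⟨rfl, rfl, rfl⟩ := SCtx.comp_es_unique hr hC
      have hLinv : L.Inv (S.env FTerm.var) := ((SCtx.inv_plug _ _ _).1
        ((SCtx.inv_plug _ _ _).1 ht).2.2.1).1
      have F := focus_after_exp hL huse hu hval hLinv
      rw [SCtx.esCount_plug]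
      obtain ⟨s, rfl⟩ | ⟨m, rfl⟩ := isHead_of_exp hu hval
      -- After an abstraction has been substituted the focus is multiplicative, so by determinism no
      -- exponential step can follow.
      · cases n with
        | zero => omega
        | succ n =>
          obtain ⟨t', h'⟩ := F.exists_mul
          rw [List.replicate_succ] at d
          obtain _ | ⟨h'', d⟩ := d
          cases (h'.deterministic h'').1
      -- The copied variable is the next focus. Its value is an abstraction, so it is bound by a
      -- frame of `S⟨L⟩`; that frame itself is counted in `S⟨L⟩` but not in the bound for the
      -- remaining steps, which pays for the current one.
      · rw [SCtx.relUnfold_eq_eval, ETerm.eval_var] at hval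
        obtain ⟨S₂, D₂, c₂, e, rfl⟩ :=
          SCtx.exists_binder _ (SCtx.lt_depth_of_isValue_env hval)
        rw [e, SCtx.comp_assoc] at F
        have key := ih d hinv (S := S₂) (c := c₂)
          (D := D₂.comp (.es (D.rename (liftRen (· + L.depth))) (.var D₂.depth))) (by
            have hd : (D₂.comp (.es (D.rename (liftRen (· + L.depth))) (.var D₂.depth))).depth =
                D₂.depth + (D.depth + 1) := by
              rw [SCtx.depth_comp, SCtx.depth, SCtx.depth_rename]
            rw [hd]
            exact F)
        have e' := congrArg SCtx.esCount e
        simp only [SCtx.esCount_comp, SCtx.esCount] at e'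
        omega

theorem Derivation.exp_length_le {n : ℕ} {t w : ETerm σ}
    (d : Derivation UStep (List.replicate n .exp) t w) (ht : t.Inv FTerm.var) :
    n ≤ t.esCount := by
  cases n with
  | zero => exact Nat.zero_le _
  | succ n =>
    have d' := d
    rw [List.replicate_succ] at d'
    obtain _ | ⟨h, -⟩ := d'
    cases h with
    | exp S D L u hL huse hu hval =>
      have := d.exp_le_esCount ht (focus_exp hL huse hval)
      simp only [SCtx.esCount_plug, ETerm.esCount] at this ⊢
      omega

/-! ### Progress -/

/-- Since the environment is normal, a redex of the unfolding cannot come from inside the value of a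
variable; it is visible in `t` up to an abstraction shared by a substitution. -/
theorem exists_focus {τ : ℕ → FTerm σ} (hτ : ∀ n, IsNormal FStep (τ n)) {t : ETerm σ}
    (ht : t.Inv τ) {s : FTerm σ} (h : FStep (t.eval τ) s) : ∃ C r, Focus τ t C r := by
  induction t generalizing τ s with
  | var n => exact (hτ n s h).elim
  | sym a => obtain ⟨a, b, h⟩ := h.exists_eq_app; cases h
  | lam t => obtain ⟨a, b, h⟩ := h.exists_eq_app; cases h
  | app t u iht ihu =>
    obtain ⟨b', hb, -⟩ | ⟨hb, a', ha, -⟩ | ⟨hb, r, hr, -⟩ :=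
      FStep.app_cases (show FStep (.app (t.eval τ) (u.eval τ)) s from h)
    · obtain ⟨C, r, F⟩ := ihu hτ ht.2 hb
      exact ⟨.right t C, r, by rw [SCtx.plug, F.plug_eq], F.evalUnder,
        SCtx.isApplicative_right.2 F.isApplicative, F.isHead, F.isValue⟩
    · obtain ⟨C, r, F⟩ := iht hτ ht.1 ha
      exact ⟨.left C u, r, by rw [SCtx.plug, F.plug_eq], ⟨F.evalUnder, hb⟩,
        SCtx.isApplicative_left.2 (.inr F.isApplicative), F.isHead, F.isValue⟩
    -- The root redex: once its outer substitutions are stripped, the left subterm is an abstraction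
    -- or a variable standing for one.
    · obtain ⟨L, v, hL, rfl, hv⟩ := t.exists_plug_not_isES
      have hval : (v.eval (L.env τ)).IsValue := by
        rw [← hL.eval_plug, hr]
        trivial
      exact ⟨.left L u, v, rfl, ⟨hL.evalUnder ((SCtx.inv_plug _ _ _).1 ht.1).1, hb⟩,
        SCtx.isApplicative_left.2 (.inl hL), ETerm.isHead_of_isValue_eval hv hval, hval⟩
  | es t u iht _ =>
    -- The content of the substitution is a fireball, hence normal, so the extended environment is
    -- still normal.
    rw [ETerm.eval_es] at h
    obtain ⟨C, r, F⟩ := iht (τ := FTerm.cons (u.eval τ) τ)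
      (fun n => by cases n with
        | zero => exact isNormal_of_isFireball ht.2.2
        | succ n => exact hτ n) ht.1 h
    exact ⟨.es C u, r, by rw [SCtx.plug, F.plug_eq], ⟨F.evalUnder, ht.2.2⟩,
      SCtx.isApplicative_es.2 F.isApplicative, F.isHead, F.isValue⟩

theorem exists_ustep {t : ETerm σ} (ht : t.Inv FTerm.var) {s : FTerm σ}
    (h : FStep t.unfold s) : ∃ k t', UStep k t t' := by
  rw [← ETerm.eval_id] at h
  obtain ⟨C, r, F⟩ := exists_focus
    (fun n s h => by obtain ⟨a, b, h⟩ := h.exists_eq_app; cases h) ht h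
  obtain ⟨s, rfl⟩ | ⟨n, rfl⟩ := F.isHead
  · obtain ⟨t', h'⟩ := F.exists_mul
    exact ⟨_, t', h'⟩
  · obtain ⟨t', h'⟩ := F.exists_exp
    exact ⟨_, t', h'⟩

end

/-! ### Derivations -/

namespace Derivation

variable {T : Type*} {C : Kind → T → T → Prop}

theorem trans {ks ls : List Kind} {t r u : T} (d : Derivation C ks t r)
    (e : Derivation C ls r u) : Derivation C (ks ++ ls) t u := by
  induction d with
  | nil t => exact e
  | cons h d ih => exact .cons h (ih e)

theorem single {k : Kind} {t u : T} (h : C k t u) : Derivation C [k] t u := .cons h (.nil u)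

theorem exists_split {ks ls : List Kind} {t u : T} (d : Derivation C (ks ++ ls) t u) :
    ∃ r, Derivation C ks t r ∧ Derivation C ls r u := by
  induction ks generalizing t with
  | nil => exact ⟨t, .nil t, d⟩
  | cons k ks ih =>
    obtain _ | ⟨h, d⟩ := d
    obtain ⟨r, d₁, d₂⟩ := ih d
    exact ⟨r, .cons h d₁, d₂⟩

end Derivation

theorem Steps.exists_derivation {T : Type*} {C : Kind → T → T → Prop} {n : ℕ} {t u : T}
    (d : Steps (anyKind C) n t u) : ∃ ks, Derivation C ks t u := by
  induction d with
  | nil t => exact ⟨[], .nil t⟩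
  | cons h d ih =>
    obtain ⟨k, h⟩ := h
    obtain ⟨ks, d'⟩ := ih
    exact ⟨k :: ks, .cons h d'⟩

theorem Derivation.steps {T : Type*} {C : Kind → T → T → Prop} {ks : List Kind} {t u : T}
    (d : Derivation C ks t u) : Steps (anyKind C) ks.length t u := by
  induction d with
  | nil t => exact .nil t
  | cons h d ih => exact .cons ⟨_, h⟩ ih

/-- Isolates the final block of exponential steps, to which the local bound applies. -/
theorem Kind.list_cases (ks : List Kind) :
    (∃ n, ks = List.replicate n .exp) ∨ ∃ l n, ks = l ++ .mul :: List.replicate n .exp := by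
  induction ks using List.reverseRecOn with
  | nil => exact .inl ⟨0, rfl⟩
  | append_singleton ks k ih =>
    cases k with
    | mul => exact .inr ⟨ks, 0, rfl⟩
    | exp =>
      obtain ⟨n, rfl⟩ | ⟨l, n, rfl⟩ := ih
      · exact .inl ⟨n + 1, List.replicate_succ'.symm⟩
      · exact .inr ⟨l, n + 1, by rw [List.replicate_succ']; simp⟩

/-! ### Quadratic bound, simulation and normalisation -/

section

variable {σ : Type*}

theorem inv_embed (t : FTerm σ) : t.embed.Inv FTerm.var := (ETerm.isPure_embed t).inv _

theorem Derivation.inv {ks : List Kind} {t : FTerm σ} {u : ETerm σ}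
    (d : Derivation UStep ks t.embed u) : u.Inv FTerm.var :=
  (d.inv_and_esCount (inv_embed t)).1

theorem Derivation.esCount_eq {ks : List Kind} {t : FTerm σ} {u : ETerm σ}
    (d : Derivation UStep ks t.embed u) : u.esCount = ks.count .mul := by
  rw [(d.inv_and_esCount (inv_embed t)).2, (ETerm.isPure_embed t).esCount_eq, zero_add]

theorem Derivation.exp_le_count {ks : List Kind} {n : ℕ} {t : FTerm σ} {u w : ETerm σ}
    (d : Derivation UStep ks t.embed u) (e : Derivation UStep (List.replicate n .exp) u w) :
    n ≤ ks.count .mul :=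
  d.esCount_eq ▸ e.exp_length_le d.inv

/-- Each block of exponential steps is at most as long as the number of multiplicative steps before
it; summing the blocks gives the bound `h ^ 2 + h` proved by induction. -/
theorem Derivation.length_le {ks : List Kind} {t : FTerm σ} {u : ETerm σ}
    (d : Derivation UStep ks t.embed u) : ks.length ≤ 2 * ks.count .mul ^ 2 := by
  have key (h : ℕ) : ∀ (ks : List Kind) (u : ETerm σ), Derivation UStep ks t.embed u →
      ks.count .mul = h → ks.length ≤ h ^ 2 + h := by
    induction h with
    | zero =>
      intro ks u d hk
      obtain ⟨n, rfl⟩ | ⟨l, n, rfl⟩ := Kind.list_cases ks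
      · simpa using (Derivation.nil t.embed).exp_le_count d
      · simp at hk
    | succ h ih =>
      intro ks u d hk
      obtain ⟨n, rfl⟩ | ⟨l, n, rfl⟩ := Kind.list_cases ks
      · simp [List.count_replicate] at hk
      -- Cut after the last multiplicative step: the block that follows has at most `h + 1` steps,
      -- and the part before that step has `h` multiplicative steps.
      · rw [List.append_cons] at d
        obtain ⟨r, d₁, d₂⟩ := d.exists_split
        obtain ⟨r', d₃, -⟩ := d₁.exists_split
        have hn := d₁.exp_le_count d₂
        simp only [List.count_append, List.count_cons_self, List.count_replicate, List.count_nil,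
          List.length_append, List.length_cons, List.length_replicate] at hk hn ⊢
        simp only [reduceCtorEq, beq_iff_eq, if_false] at hk
        have := ih l r' d₃ (by omega)
        nlinarith
  have := key _ ks u d rfl
  -- The linear term is absorbed by the square, whence the constant 2.
  have := Nat.le_self_pow two_ne_zero (ks.count .mul)
  omega

/-- After a derivation, exponential steps can be performed until none is left. -/
theorem Derivation.exists_exp_normal {ks : List Kind} {t : FTerm σ} {u : ETerm σ}
    (d : Derivation UStep ks t.embed u) :
    ∃ (ls : List Kind) (w : ETerm σ), Derivation UStep ls t.embed w ∧
      ls.count .mul = ks.count .mul ∧ w.unfold = u.unfold ∧ IsNormal (UStep .exp) w := by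
  -- Otherwise exponential steps could be prolonged forever, against the local bound; one step more
  -- than the number of multiplicative steps suffices.
  by_contra! H
  have key (n : ℕ) : ∃ w, Derivation UStep (List.replicate n .exp) u w ∧
      w.unfold = u.unfold := by
    induction n with
    | zero => exact ⟨u, .nil u, rfl⟩
    | succ n ih =>
      obtain ⟨w, e, hw⟩ := ih
      have hn := H _ w (d.trans e) (by simp [List.count_replicate]) hw
      simp only [IsNormal, not_forall, not_not] at hn
      obtain ⟨w', h⟩ := hn
      refine ⟨w', ?_, by rw [← h.unfold_eq, hw]⟩
      rw [List.replicate_succ']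
      exact e.trans (.single h)
  obtain ⟨w, e, -⟩ := key (ks.count .mul + 1)
  have := d.exp_le_count e
  omega

theorem Derivation.isNormal_unfold {ks : List Kind} {t : FTerm σ} {u : ETerm σ}
    (d : Derivation UStep ks t.embed u) (hu : IsNormal (anyKind UStep) u) :
    IsNormal FStep u.unfold := by
  intro s h
  obtain ⟨k, t', h'⟩ := exists_ustep d.inv h
  exact hu t' ⟨k, h'⟩

theorem Derivation.steps_of_embed {ks : List Kind} {t : FTerm σ} {u : ETerm σ}
    (d : Derivation UStep ks t.embed u) : Steps FStep (ks.count .mul) t u.unfold := by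
  simpa [FTerm.unfold_embed] using d.steps_unfold

/-- Every derivation of the Fireball Calculus is simulated by the useful strategy. -/
theorem Derivation.exists_simulation {h : ℕ} {r s : FTerm σ} (e : Steps FStep h r s)
    {ks : List Kind} {t : FTerm σ} {u : ETerm σ} (d : Derivation UStep ks t.embed u)
    (hu : u.unfold = r) :
    ∃ (ls : List Kind) (w : ETerm σ), Derivation UStep ls t.embed w ∧ w.unfold = s ∧
      ls.count .mul = ks.count .mul + h := by
  induction e generalizing ks u with
  | nil r => exact ⟨ks, u, d, hu, rfl⟩
  | @cons n r r' s hr e ih =>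
    -- With exponential steps exhausted, the step given by progress is multiplicative, and
    -- determinism of `FStep` identifies its projection with the given step.
    obtain ⟨ls, w, d', hc, hw, hn⟩ := d.exists_exp_normal
    have hr' : FStep w.unfold r' := by rwa [hw, hu]
    obtain ⟨k, w', h'⟩ := exists_ustep d'.inv hr'
    cases k with
    | exp => exact (hn w' h').elim
    | mul =>
      obtain ⟨ls', v, dv, hv, hc'⟩ :=
        ih (d'.trans (.single h')) (h'.fstep_unfold.deterministic hr')
      refine ⟨ls', v, dv, hv, ?_⟩
      rw [hc', List.count_append, hc, List.count_singleton_self]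
      omega

/-- Left to right, the simulation followed by exhaustion of exponential steps ends in a normal form,
since a multiplicative step would project on a step from a normal term. The converse is projection.
-/
theorem isNormalising_iff (t : FTerm σ) :
    IsNormalising FStep t ↔ IsNormalising (anyKind UStep) t.embed := by
  constructor
  · rintro ⟨n, s, e, hs⟩
    obtain ⟨ks, u, d, hu, -⟩ :=
      Derivation.exists_simulation e (.nil t.embed) (FTerm.unfold_embed t)
    obtain ⟨ls, w, d', -, hw, hn⟩ := d.exists_exp_normal
    refine ⟨_, w, d'.steps, ?_⟩
    rintro w' ⟨k, h⟩
    cases k with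
    | exp => exact hn w' h
    | mul =>
      have := h.fstep_unfold
      rw [hw, hu] at this
      exact hs _ this
  · rintro ⟨n, u, e, hu⟩
    obtain ⟨ks, d⟩ := e.exists_derivation
    exact ⟨_, _, d.steps_of_embed, d.isNormal_unfold hu⟩

end

end FireballCalculus

open FireballCalculus
theorem mainTheorem6 (σ : Type*) :
    IsHighLevelImplementationSystem (FStep (σ := σ)) (UStep (σ := σ)) ∧
    IsLocallyBounded (UStep (σ := σ)) ∧
    ImplementsWithQuadraticOverhead (FStep (σ := σ)) (UStep (σ := σ)) := by
  refine ⟨⟨fun _ _ _ => FStep.deterministic, fun _ _ _ _ _ => UStep.deterministic,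
    fun _ _ _ d => d.isNormal_unfold, fun _ _ _ d => d.steps_unfold⟩, ⟨1, ?_⟩,
    isNormalising_iff, 2, ?_, ?_⟩
  · intro t ks u d n w e
    simpa using d.exp_le_count e
  · intro t ks u d
    exact ⟨_, rfl, d.steps_of_embed, d.length_le⟩
  · intro t s h e
    obtain ⟨ks, u, d, hu, hc⟩ :=
      Derivation.exists_simulation e (.nil t.embed) (FTerm.unfold_embed t)
    rw [List.count_nil, zero_add] at hc
    exact ⟨ks, u, d, hu, hc, hc ▸ d.length_le⟩
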